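/- For a finite group $X$ let $\mathrm{ccl}(X)$ be the number of conjugacy classes of $X$, and let $X'$ be the derived subgroup. Let $\pi$ be a set of primes and $\pi'$ its complement in the set of all primes. A Hall $\pi$-subgroup of $X$ is a subgroup whose order has all its prime divisors in $\pi$ and whose index has all its prime divisors in $\pi'$. For a finite soluble group $X$ let $A$ be a Hall $\pi$-subgroup and $B$ a Hall $\pi'$-subgroup of $X$ (they exist and are unique up to conjugacy). Then $X$ is called - $\mathrm{Con}_\pi$ if $\mathrm{ccl}(X)\le \mathrm{ccl}(A)\,\mathrm{ccl}(B)$; - $\mathrm{Con}^*_\pi$ if $\mathrm{ccl}(X)<\mathrm{ccl}(A)\,\mathrm{ccl}(B)$ or $X\cong A\times B$; - $\mathrm{SCon}_\pi$ if it is $\mathrm{Con}_\pi$ and, for every central subgroup $N$ of $X$ of prime order $p$, one has $\mathrm{ccl}(X)-\mathrm{ccl}(X/N)\le(\mathrm{ccl}(A)-\mathrm{ccl}(A/N))\,\mathrm{ccl}(B)$ if $p\in\pi$, and $\mathrm{ccl}(X)-\mathrm{ccl}(X/N)\le(\mathrm{ccl}(B)-\mathrm{ccl}(B/N))\,\mathrm{ccl}(A)$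 if $p\in\pi'$. **Theorem D.** Let $\pi$ be a set of primes and let $G$ be a finite soluble group. Suppose that $M$ is a central subgroup of $G$ of prime order such that $M\cap G'=1$ and every subgroup of $G/M$ is $\mathrm{Con}_\pi$. Then: 1. $G$ is $\mathrm{Con}_\pi$. 2. If $G/M$ is $\mathrm{Con}^*_\pi$, then $G$ is $\mathrm{Con}^*_\pi$. 3. If every central subgroup $L$ of $G$ of prime order satisfies the same conditions (that is, $L\cap G'=1$ and every subgroup of $G/L$ is $\mathrm{Con}_\pi$), then $G$ is $\mathrm{SCon}_\pi$. 4. If $Z(G)\cap G'=1$, then $G$ is $\mathrm{SCon}_\pi$. -/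

import Mathlib

/-- The number of conjugacy classes of a (finite) group. -/
noncomputable def ccl (G : Type*) [Group G] : ℕ :=
  Nat.card (ConjClasses G)

/-- A `π`-number: a positive integer all of whose prime divisors lie in `π`. -/
def IsPiNumber (π : Set Nat.Primes) (n : ℕ) : Prop :=
  n ≠ 0 ∧ ∀ p : Nat.Primes, (p : ℕ) ∣ n → p ∈ π

/-- A Hall `π`-subgroup: its order is a `π`-number and its index is a `π'`-number,
where `π'` is the complement of `π` in the set of all primes. -/
def IsHall (π : Set Nat.Primes) {G : Type*} [Group G] (H : Subgroup G) : Prop :=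
  IsPiNumber π (Nat.card H) ∧ IsPiNumber πᶜ H.index

/-- `Con_π` (a property of finite soluble groups): `ccl(G) ≤ ccl(A) ccl(B)` for
`A` a Hall `π`-subgroup and `B` a Hall `π'`-subgroup of `G`. -/
def ConPi (π : Set Nat.Primes) (G : Type*) [Group G] : Prop :=
  ∀ A B : Subgroup G, IsHall π A → IsHall πᶜ B → ccl G ≤ ccl A * ccl B

/-- `Con_π^*` (a property of finite soluble groups): either `ccl(G) < ccl(A) ccl(B)` or
`G ≅ A × B`, for `A` a Hall `π`-subgroup and `B` a Hall `π'`-subgroup of `G`. -/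
def ConPiStar (π : Set Nat.Primes) (G : Type*) [Group G] : Prop :=
  ∀ A B : Subgroup G, IsHall π A → IsHall πᶜ B →
    ccl G < ccl A * ccl B ∨ Nonempty (G ≃* A × B)

/-- The additional inequality in `SCon_π`: whenever `N` is a central subgroup of `G` of order
`p ∈ π`, then `ccl(G) - ccl(G/N) ≤ (ccl(A) - ccl(A/N)) ccl(B)`, as integers, for `A` a Hall
`π`-subgroup and `B` a Hall `π'`-subgroup of `G`. Here `N.subgroupOf A` is `N` as a subgroup of
`A`; a Hall `π`-subgroup contains every normal `π`-subgroup, so `N ≤ A`. -/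
def CentralIneq (π : Set Nat.Primes) (G : Type*) [Group G] : Prop :=
  ∀ (N : Subgroup G) [N.Normal], N ≤ Subgroup.center G →
    ∀ p : Nat.Primes, p ∈ π → Nat.card N = p →
      ∀ A B : Subgroup G, IsHall π A → IsHall πᶜ B →
        (ccl G : ℤ) - ccl (G ⧸ N) ≤ ((ccl A : ℤ) - ccl (A ⧸ N.subgroupOf A)) * ccl B

/-- `SCon_π` (a property of finite soluble groups): `G` is `Con_π`, and the inequality for central
subgroups of prime order holds for the primes in `π` and, with the roles of `π` and `π'`
exchanged, for the primes in `π'`. -/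
def SConPi (π : Set Nat.Primes) (G : Type*) [Group G] : Prop :=
  ConPi π G ∧ CentralIneq π G ∧ CentralIneq πᶜ G

/-! A commutator lying in `M` is trivial because `M` meets `G'` trivially, so the projection from
`G` to `G/M` reflects commutation, and so does its restriction to any subgroup. Such surjections
preserve the commuting probability `ccl X / |X|`. Since `|A| |B| = |G|`, the bound `ccl G ≤ ccl A *
ccl B` says `commProb G ≤ commProb A * commProb B`, so it lifts from `G/M` to `G`, and so does its
strict form. In the equality case of `ConPiStar`, splitting means that `A` and `B` commute
elementwise, which is reflected too. For `SConPi`, `ccl` of `G` and of `A` is `p` times that of the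
quotient by `N`, so the inequality is a multiple of the `ConPi` bound. -/

namespace MonoidHom

variable {G H : Type*} [Group G] [Group H]

/-- A surjective homomorphism identifies the underlying set of its domain with the product of its
codomain and its kernel. -/
noncomputable def equivProdKer (f : G →* H) (hf : Function.Surjective f) : G ≃ H × f.ker where
  toFun x := (f x, ⟨(Function.surjInv hf (f x))⁻¹ * x, by
    simp [MonoidHom.mem_ker, Function.surjInv_eq hf]⟩)
  invFun y := Function.surjInv hf y.1 * y.2
  left_inv x := by simp
  right_inv y := by
    obtain ⟨h, k, hk⟩ := y
    have hfk : f (Function.surjInv hf h * k) = h := by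
      rw [map_mul, Function.surjInv_eq hf, (MonoidHom.mem_ker).1 hk, mul_one]
    ext <;> simp [hfk]

theorem card_eq_card_mul_card_ker (f : G →* H) (hf : Function.Surjective f) :
    Nat.card G = Nat.card H * Nat.card f.ker := by
  rw [Nat.card_congr (f.equivProdKer hf), Nat.card_prod]

/-- A surjection that reflects commutation preserves the commuting probability. -/
theorem commProb_eq_of_commute [Finite G] (f : G →* H) (hf : Function.Surjective f)
    (hcomm : ∀ x y, Commute (f x) (f y) → Commute x y) : commProb G = commProb H := by
  have : Finite H := Finite.of_surjective f hf
  -- Whether a pair commutes depends only on its image, so the kernel coordinates are free.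
  have e : {p : G × G // Commute p.1 p.2} ≃
      {p : H × H // Commute p.1 p.2} × (f.ker × f.ker) :=
    { toFun := fun p =>
        (⟨(f p.1.1, f p.1.2), p.2.map f⟩,
          ((f.equivProdKer hf p.1.1).2, (f.equivProdKer hf p.1.2).2))
      invFun := fun q =>
        ⟨((f.equivProdKer hf).symm (q.1.1.1, q.2.1), (f.equivProdKer hf).symm (q.1.1.2, q.2.2)), by
          have h (z : H × f.ker) : f ((f.equivProdKer hf).symm z) = z.1 :=
            congrArg Prod.fst ((f.equivProdKer hf).apply_symm_apply z)
          apply hcomm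
          rw [h, h]
          exact q.1.2⟩
      left_inv := fun p => Subtype.ext (Prod.ext
        ((f.equivProdKer hf).symm_apply_apply p.1.1) ((f.equivProdKer hf).symm_apply_apply p.1.2))
      right_inv := fun q => by
        have h (z : H × f.ker) : f ((f.equivProdKer hf).symm z) = z.1 :=
          congrArg Prod.fst ((f.equivProdKer hf).apply_symm_apply z)
        have h' (z : H × f.ker) : (f.equivProdKer hf ((f.equivProdKer hf).symm z)).2 = z.2 :=
          congrArg Prod.snd ((f.equivProdKer hf).apply_symm_apply z)
        exact Prod.ext (Subtype.ext (Prod.ext (h _) (h _))) (Prod.ext (h' _) (h' _)) }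
  have hH : (Nat.card H : ℚ) ≠ 0 := by exact_mod_cast Nat.card_pos.ne'
  have hk : (Nat.card f.ker : ℚ) ≠ 0 := by exact_mod_cast Nat.card_pos.ne'
  rw [commProb_def, commProb_def, Nat.card_congr e, Nat.card_prod, Nat.card_prod,
    f.card_eq_card_mul_card_ker hf]
  push_cast
  field_simp

/-- A homomorphism whose kernel meets the commutator subgroup trivially reflects commutation. -/
theorem commute_of_ker_inf_commutator (f : G →* H) (hf : f.ker ⊓ commutator G = ⊥) (x y : G)
    (h : Commute (f x) (f y)) : Commute x y := by
  rw [← commutatorElement_eq_one_iff_commute] at h ⊢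
  rw [← Subgroup.mem_bot, ← hf]
  refine Subgroup.mem_inf.2 ⟨by rw [MonoidHom.mem_ker, map_commutatorElement, h], ?_⟩
  exact Subgroup.commutator_mem_commutator (Subgroup.mem_top x) (Subgroup.mem_top y)

end MonoidHom

theorem commProb_map_eq {G H : Type*} [Group G] [Group H] [Finite G] (f : G →* H)
    (hcomm : ∀ x y, Commute (f x) (f y) → Commute x y) (A : Subgroup G) :
    commProb A = commProb (A.map f) :=
  (f.subgroupMap A).commProb_eq_of_commute (f.subgroupMap_surjective A) fun x y h =>
    Subtype.ext (hcomm x y (congrArg Subtype.val h))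

theorem ccl_eq_commProb_mul_card (G : Type*) [Group G] [Finite G] :
    (ccl G : ℚ) = commProb G * Nat.card G := by
  have hG : (Nat.card G : ℚ) ≠ 0 := by exact_mod_cast Nat.card_pos.ne'
  rw [commProb_def', ccl, div_mul_cancel₀ _ hG]

theorem ccl_eq_ccl_mul_card_ker {G H : Type*} [Group G] [Group H] [Finite G] (f : G →* H)
    (hf : Function.Surjective f) (hcomm : ∀ x y, Commute (f x) (f y) → Commute x y) :
    ccl G = ccl H * Nat.card f.ker := by
  have : Finite H := Finite.of_surjective f hf
  have h := ccl_eq_commProb_mul_card G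
  rw [f.commProb_eq_of_commute hf hcomm, f.card_eq_card_mul_card_ker hf, Nat.cast_mul,
    ← mul_assoc, ← ccl_eq_commProb_mul_card H] at h
  exact_mod_cast h

namespace IsPiNumber

theorem of_dvd {π : Set Nat.Primes} {m n : ℕ} (hn : IsPiNumber π n) (h : m ∣ n) :
    IsPiNumber π m :=
  ⟨ne_zero_of_dvd_ne_zero hn.1 h, fun p hp => hn.2 p (hp.trans h)⟩

theorem coprime {π : Set Nat.Primes} {m n : ℕ} (hm : IsPiNumber π m) (hn : IsPiNumber πᶜ n) :
    m.Coprime n :=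
  Nat.coprime_of_dvd fun p hp hpm hpn => hn.2 ⟨p, hp⟩ hpn (hm.2 ⟨p, hp⟩ hpm)

end IsPiNumber

namespace IsHall

variable {π : Set Nat.Primes} {G : Type*} [Group G]

theorem map {H : Type*} [Group H] {A : Subgroup G} (hA : IsHall π A) {f : G →* H}
    (hf : Function.Surjective f) : IsHall π (A.map f) :=
  ⟨hA.1.of_dvd (Subgroup.card_map_dvd A f), hA.2.of_dvd (A.index_map_dvd hf)⟩

/-- By coprimality, `|B|` and the index of `A` divide each other. -/
theorem card_mul_card {A B : Subgroup G} (hA : IsHall π A) (hB : IsHall πᶜ B) :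
    Nat.card A * Nat.card B = Nat.card G := by
  have hAB := A.card_mul_index.trans B.card_mul_index.symm
  have h₁ : Nat.card B ∣ A.index :=
    (hA.1.coprime hB.1).symm.dvd_of_dvd_mul_left (hAB ▸ Dvd.intro _ rfl)
  have h₂ : A.index ∣ Nat.card B :=
    (hA.2.coprime hB.2).dvd_of_dvd_mul_right (hAB ▸ Dvd.intro_left _ rfl)
  rw [Nat.dvd_antisymm h₁ h₂, A.card_mul_index]

theorem isComplement' [Finite G] {A B : Subgroup G} (hA : IsHall π A) (hB : IsHall πᶜ B) :
    A.IsComplement' B :=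
  Subgroup.isComplement'_of_coprime (hA.card_mul_card hB) (hA.1.coprime hB.1)

/-- A Hall `π`-subgroup contains every central subgroup of prime order `p ∈ π`. -/
theorem le_of_central [Finite G] {A N : Subgroup G} (hA : IsHall π A)
    (hN : N ≤ Subgroup.center G) {p : Nat.Primes} (hp : p ∈ π) (hNp : Nat.card N = p) :
    N ≤ A := by
  have : Fact (Nat.card N).Prime := ⟨hNp ▸ p.2⟩
  rcases (A.subgroupOf N).eq_bot_or_eq_top_of_prime_card with h | h
  · exfalso
    rw [Subgroup.subgroupOf_eq_bot] at h
    have hcomm (a : A) (n : N) : Commute (A.subtype a) (N.subtype n) :=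
      Subgroup.mem_center_iff.1 (hN n.2) a
    -- If `N` met `A` trivially, `A × N` would embed in `G`, so `p` would divide the index of `A`.
    have hinj : Function.Injective (MonoidHom.noncommCoprod A.subtype N.subtype hcomm) := by
      rw [MonoidHom.noncommCoprod_injective]
      simpa using h
    have hdvd := Subgroup.card_dvd_of_injective _ hinj
    rw [Nat.card_prod, ← A.card_mul_index, hNp] at hdvd
    exact hA.2.2 p (Nat.dvd_of_mul_dvd_mul_left Nat.card_pos hdvd) hp
  · exact Subgroup.subgroupOf_eq_top.1 h

/-- If the group is the direct product of a Hall `π`-subgroup and a Hall `π'`-subgroup, then all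
their elements commute. -/
theorem commute_of_mulEquiv {A B : Subgroup G} (hA : IsHall π A) (hB : IsHall πᶜ B)
    (e : G ≃* A × B) {a b : G} (ha : a ∈ A) (hb : b ∈ B) : Commute a b := by
  -- The order of this coordinate divides both `|A|` and `|B|`.
  have h₁ : (e a).2 = 1 := orderOf_eq_one_iff.1 <| Nat.eq_one_of_dvd_coprimes (hA.1.coprime hB.1)
    ((orderOf_map_dvd ((MonoidHom.snd A B).comp e.toMonoidHom) a).trans
      (A.orderOf_dvd_natCard ha)) (orderOf_dvd_natCard _)
  have h₂ : (e b).1 = 1 := orderOf_eq_one_iff.1 <| Nat.eq_one_of_dvd_coprimes (hA.1.coprime hB.1)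
    (orderOf_dvd_natCard _) ((orderOf_map_dvd ((MonoidHom.fst A B).comp e.toMonoidHom) b).trans
      (B.orderOf_dvd_natCard hb))
  apply e.injective
  rw [map_mul, map_mul]
  ext <;> simp [h₁, h₂]

theorem nonempty_mulEquiv [Finite G] {A B : Subgroup G} (hA : IsHall π A) (hB : IsHall πᶜ B)
    (hcomm : ∀ a ∈ A, ∀ b ∈ B, Commute a b) : Nonempty (G ≃* A × B) :=
  ⟨(MulEquiv.ofBijective (MonoidHom.noncommCoprod A.subtype B.subtype
    fun a b => hcomm a a.2 b b.2) (hA.isComplement' hB)).symm⟩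

theorem commProb_mul_eq [Finite G] {A B : Subgroup G} (hA : IsHall π A) (hB : IsHall πᶜ B) :
    ((ccl A * ccl B : ℕ) : ℚ) = commProb A * commProb B * Nat.card G := by
  rw [Nat.cast_mul, ccl_eq_commProb_mul_card, ccl_eq_commProb_mul_card, ← hA.card_mul_card hB,
    Nat.cast_mul]
  ring

theorem ccl_le_iff [Finite G] {A B : Subgroup G} (hA : IsHall π A) (hB : IsHall πᶜ B) :
    ccl G ≤ ccl A * ccl B ↔ commProb G ≤ commProb A * commProb B := by
  have hG : (0 : ℚ) < Nat.card G := by exact_mod_cast Nat.card_pos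
  rw [← Nat.cast_le (α := ℚ), hA.commProb_mul_eq hB, ccl_eq_commProb_mul_card,
    mul_le_mul_iff_left₀ hG]

theorem ccl_lt_iff [Finite G] {A B : Subgroup G} (hA : IsHall π A) (hB : IsHall πᶜ B) :
    ccl G < ccl A * ccl B ↔ commProb G < commProb A * commProb B := by
  have hG : (0 : ℚ) < Nat.card G := by exact_mod_cast Nat.card_pos
  rw [← Nat.cast_lt (α := ℚ), hA.commProb_mul_eq hB, ccl_eq_commProb_mul_card,
    mul_lt_mul_iff_left₀ hG]

end IsHall

section Lifting

variable {π : Set Nat.Primes} {G H : Type*} [Group G] [Group H]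

theorem ConPi.compl (h : ConPi π G) : ConPi πᶜ G := fun A B hA hB =>
  (h B A (compl_compl π ▸ hB) hA).trans_eq (mul_comm _ _)

theorem ConPi.of_surjective [Finite G] (h : ConPi π H) (f : G →* H)
    (hf : Function.Surjective f) (hcomm : ∀ x y, Commute (f x) (f y) → Commute x y) :
    ConPi π G := fun A B hA hB => by
  have : Finite H := Finite.of_surjective f hf
  rw [hA.ccl_le_iff hB, f.commProb_eq_of_commute hf hcomm, commProb_map_eq f hcomm A,
    commProb_map_eq f hcomm B, ← (hA.map hf).ccl_le_iff (hB.map hf)]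
  exact h _ _ (hA.map hf) (hB.map hf)

theorem ConPiStar.of_surjective [Finite G] (h : ConPiStar π H) (f : G →* H)
    (hf : Function.Surjective f) (hcomm : ∀ x y, Commute (f x) (f y) → Commute x y) :
    ConPiStar π G := fun A B hA hB => by
  have : Finite H := Finite.of_surjective f hf
  refine (h _ _ (hA.map hf) (hB.map hf)).imp (fun hlt => ?_) fun ⟨e⟩ => ?_
  · rwa [hA.ccl_lt_iff hB, f.commProb_eq_of_commute hf hcomm, commProb_map_eq f hcomm A,
      commProb_map_eq f hcomm B, ← (hA.map hf).ccl_lt_iff (hB.map hf)]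
  · exact hA.nonempty_mulEquiv hB fun a ha b hb => hcomm a b <|
      (hA.map hf).commute_of_mulEquiv (hB.map hf) e (Subgroup.mem_map_of_mem f ha)
        (Subgroup.mem_map_of_mem f hb)

theorem ConPi.centralIneq [Finite G] (h : ConPi π G)
    (hG : ∀ L : Subgroup G, L ≤ Subgroup.center G → (Nat.card L).Prime → L ⊓ commutator G = ⊥) :
    CentralIneq π G := by
  intro N _ hN p hp hNp A B hA hB
  have hNA : N ≤ A := hA.le_of_central hN hp hNp
  have hcomm : ∀ x y : G, Commute (QuotientGroup.mk' N x) (QuotientGroup.mk' N y) →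
      Commute x y := MonoidHom.commute_of_ker_inf_commutator _ <| by
    rw [QuotientGroup.ker_mk']
    exact hG N hN (hNp ▸ p.2)
  have h₁ := ccl_eq_ccl_mul_card_ker _ (QuotientGroup.mk'_surjective N) hcomm
  have h₂ := ccl_eq_ccl_mul_card_ker _ (QuotientGroup.mk'_surjective (N.subgroupOf A))
    fun x y hxy => Subtype.ext <| hcomm x y <| by
      have hmap := hxy.map (QuotientGroup.map (N.subgroupOf A) N A.subtype le_rfl)
      exact hmap
  rw [QuotientGroup.ker_mk', hNp] at h₁
  rw [QuotientGroup.ker_mk', Nat.card_congr (Subgroup.subgroupOfEquivOfLe hNA).toEquiv, hNp] at h₂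
  have hle := h A B hA hB
  have hp0 : 0 < (p : ℕ) := p.2.pos
  rw [h₁, h₂, mul_right_comm, Nat.mul_le_mul_right_iff hp0] at hle
  rw [h₁, h₂]
  have hp1 : (1 : ℤ) ≤ (p : ℕ) := by exact_mod_cast hp0
  zify at hle
  push_cast
  -- The goal is `ccl (G/N) ≤ ccl (A/N) * ccl B`, the `ConPi` bound divided by `p`, multiplied by `p
  -- - 1`.
  nlinarith [mul_le_mul_of_nonneg_right hle (sub_nonneg.2 hp1)]

theorem ConPi.sconPi [Finite G] (h : ConPi π G)
    (hG : ∀ L : Subgroup G, L ≤ Subgroup.center G → (Nat.card L).Prime → L ⊓ commutator G = ⊥) :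
    SConPi π G :=
  ⟨h, h.centralIneq hG, h.compl.centralIneq hG⟩

end Lifting

theorem theoremD (π : Set Nat.Primes) (G : Type*) [Group G] [Finite G] [Group.IsSolvable G]
    (M : Subgroup G) [M.Normal] (hMcentral : M ≤ Subgroup.center G)
    (hMprime : (Nat.card M).Prime) (hMinf : M ⊓ commutator G = ⊥)
    (hMcon : ∀ H : Subgroup (G ⧸ M), ConPi π H) :
    ConPi π G ∧
    (ConPiStar π (G ⧸ M) → ConPiStar π G) ∧
    ((∀ (L : Subgroup G) [L.Normal], L ≤ Subgroup.center G → (Nat.card L).Prime →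
        L ⊓ commutator G = ⊥ ∧ ∀ H : Subgroup (G ⧸ L), ConPi π H) → SConPi π G) ∧
    (Subgroup.center G ⊓ commutator G = ⊥ → SConPi π G) := by
  have hsurj := QuotientGroup.mk'_surjective M
  have hcomm := (QuotientGroup.mk' M).commute_of_ker_inf_commutator <| by
    rwa [QuotientGroup.ker_mk']
  have hquot : ConPi π (G ⧸ M) := (hMcon ⊤).of_surjective
    (Subgroup.topEquiv (G := G ⧸ M)).symm.toMonoidHom
    (Subgroup.topEquiv (G := G ⧸ M)).symm.surjective fun x y h => congrArg Subtype.val h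
  have hcon : ConPi π G := hquot.of_surjective _ hsurj hcomm
  refine ⟨hcon, fun h => h.of_surjective _ hsurj hcomm, fun h => hcon.sconPi fun L hL hLp => ?_,
    fun h => hcon.sconPi fun L hL _ => ?_⟩
  · have : L.Normal := ⟨fun n hn g => by
      rwa [Subgroup.mem_center_iff.1 (hL hn) g, mul_inv_cancel_right]⟩
    exact (h L hL hLp).1
  · exact eq_bot_iff.2 ((inf_le_inf_right _ hL).trans h.le)
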